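/- Let $\mathfrak g$ be a real vector space of finite dimension $n$. A Lie algebra structure on $\mathfrak g$ is an alternating bilinear map $\mu:\mathfrak g\times\mathfrak g\to\mathfrak g$ satisfying the Jacobi identity; write $[x,y]=\mu(x,y)$, and for subspaces $A,B\subset\mathfrak g$ let $[A,B]$ be the linear span of all $[a,b]$ with $a\in A$, $b\in B$. Let $\mathfrak g^0=\mathfrak g$, $\mathfrak g^{i+1}=[\mathfrak g^i,\mathfrak g]$ be the descending central series; $\mu$ is nilpotent if $\mathfrak g^k=0$ for some $k$. For $k\ge 1$ put $$N_k(\mu)(x_1,\dots,x_{k+1})=[\dots[[x_1,x_2],x_3],\dots,x_{k+1}],$$ and for $k\ge 3$ put $$SN_k(\mu)(x_1,\dots,x_{k+1})=\big[[x_1,x_2],\,N_{k-2}(\mu)(x_3,\dots,x_{k+1})\big].$$ Let $\mathcal N_{n,k}$ be the set of Lie algebra structures $\mu$ on $\mathfrak g$ with $\mathfrak g^k=0$ (that is, at most $k$-step nilpotent), and let $\mathcal{SN}_{n,k}$ be the set of Lie algebra structures $\mu$ on $\mathfrak g$ with $SN_k(\mu)=0$ identically. Then $$\mathcal N_{n,4}\subset\mathcal{SN}_{n,3}\quad\text{for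 } n=5,6,7,\qquad\text{and}\qquad \mathcal N_{7,6}\subset\mathcal{SN}_{7,5}.$$ That is, every at most 4-step nilpotent real Lie algebra of dimension 5, 6 or 7 satisfies $[[x_1,x_2],[x_3,x_4]]=0$ for all $x_1,\dots,x_4$, and every at most 6-step nilpotent real Lie algebra of dimension 7 satisfies $\big[[x_1,x_2],[[[x_3,x_4],x_5],x_6]\big]=0$ for all $x_1,\dots,x_6$. In particular, every nilpotent real Lie algebra of dimension 7 satisfies $[\mathfrak g^1,\mathfrak g^3]=0$. -/

import Mathlib

namespace NilVar

variable {V : Type*} [AddCommGroup V] [Module ℝ V]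

/-- The space of alternating bilinear maps `V × V → V`, i.e. `Λ²V* ⊗ V`. -/
abbrev Alt2 (V : Type*) [AddCommGroup V] [Module ℝ V] : Type _ := V [⋀^Fin 2]→ₗ[ℝ] V

/-- The Jacobi operator `J(μ)(x,y,z) = ∑_cyclic μ(μ(x,y),z)`. -/
def jacobi (μ : Alt2 V) (x y z : V) : V :=
  μ ![μ ![x, y], z] + μ ![μ ![y, z], x] + μ ![μ ![z, x], y]

/-- `𝓛`: the Lie algebra structures on `V`. -/
def lieStructures (V : Type*) [AddCommGroup V] [Module ℝ V] : Set (Alt2 V) :=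
  {μ | ∀ x y z : V, jacobi μ x y z = 0}

/-- `[A, B]`: the linear span of all brackets `μ(a,b)` with `a ∈ A`, `b ∈ B`. -/
def bracket (μ : Alt2 V) (A B : Submodule ℝ V) : Submodule ℝ V :=
  Submodule.span ℝ {z | ∃ a ∈ A, ∃ b ∈ B, μ ![a, b] = z}

/-- The descending central series `𝔤⁰ = 𝔤`, `𝔤ⁱ⁺¹ = [𝔤ⁱ, 𝔤]`. -/
def lcs (μ : Alt2 V) : ℕ → Submodule ℝ V
  | 0 => ⊤
  | i + 1 => bracket μ (lcs μ i) ⊤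

/-- `𝓝_{n,k}` (with `n = dim V`): the Lie algebra structures with `𝔤ᵏ = 0`, i.e. those that are
at most `k`-step nilpotent. -/
def nilStructures (V : Type*) [AddCommGroup V] [Module ℝ V] (k : ℕ) : Set (Alt2 V) :=
  {μ | μ ∈ lieStructures V ∧ lcs μ k = ⊥}

/-- `𝓝_n` (with `n = dim V`): all nilpotent Lie algebra structures. -/
def allNilStructures (V : Type*) [AddCommGroup V] [Module ℝ V] : Set (Alt2 V) :=
  {μ | μ ∈ lieStructures V ∧ ∃ k : ℕ, lcs μ k = ⊥}

/-- The left-normed iterated bracket `N_k(μ)(x₁,…,x_{k+1}) = μ(…μ(μ(x₁,x₂),x₃)…,x_{k+1})`,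
started at `N_0(μ)(x₁) = x₁`. -/
def nilOp (μ : Alt2 V) : (k : ℕ) → (Fin (k + 1) → V) → V
  | 0, x => x 0
  | k + 1, x => μ ![nilOp μ k (fun i => x i.castSucc), x (Fin.last (k + 1))]

/-- `SN_k(μ)(x₁,…,x_{k+1}) = μ(μ(x₁,x₂), N_{k-2}(μ)(x₃,…,x_{k+1}))` for `k ≥ 3`
(arguments are indexed from `0` here). -/
def snOp (μ : Alt2 V) (k : ℕ) (hk : 3 ≤ k) (x : Fin (k + 1) → V) : V :=
  μ ![μ ![x ⟨0, by omega⟩, x ⟨1, by omega⟩],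
    nilOp μ (k - 2) (fun i => x ⟨i.val + 2, by omega⟩)]

/-- `𝓢𝓝_{n,k}` (with `n = dim V`): the Lie algebra structures with `SN_k(μ) = 0`. -/
def snStructures (V : Type*) [AddCommGroup V] [Module ℝ V] (k : ℕ) (hk : 3 ≤ k) :
    Set (Alt2 V) :=
  {μ | μ ∈ lieStructures V ∧ ∀ x : Fin (k + 1) → V, snOp μ k hk x = 0}

end NilVar

/-! Since $[\mathfrak g^i,\mathfrak g^j]\subset\mathfrak g^{i+j+1}$ and a stationary step of the
series vanishes, a nonzero bracket forces lower bounds on the dimensions of the quotients $\mathfrak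
g^i/\mathfrak g^{i+1}$. In dimension at most 7 these leave one extremal shape in each case, which
the Jacobi identity excludes.

If $\mathfrak g^4=0$ and $[\mathfrak g^1,\mathfrak g^1]\ne0$, the shape is (3,2,1,1). The generators
can be chosen with $[a,b]\in\mathfrak g^2$, so only $[p,q]$ with $p=[a,c]$, $q=[b,c]$ matters;
`toBilin_toBilin_eq_zero_of_generators` shows that it vanishes.

If $[\mathfrak g^1,\mathfrak g^3]\ne0$ then $\mathfrak g^5\ne0$, and the shape is (2,1,1,1,1,1), the
filiform one, with $\mathfrak g^6=0$. Now $[\mathfrak g^1,\mathfrak g^3]$ is spanned by $[p,f]$ with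
$p=[a,b]$, $f=[[p,a],a]$, and `toBilin_lcs_one_lcs_three_eq_zero_of_filiform` shows that it
vanishes. -/

namespace NilVar

variable {V : Type*} [AddCommGroup V] [Module ℝ V]

/-! ### The bracket and the descending central series -/

/-- An alternating map in two variables as a bilinear map. -/
def toBilin (μ : Alt2 V) : V →ₗ[ℝ] V →ₗ[ℝ] V :=
  have swap : ∀ x y : V, μ ![x, y] = -μ ![y, x] := fun x y => by
    have h := μ.map_swap ![x, y] (i := 0) (j := 1) (by decide)
    have e : (![x, y] ∘ Equiv.swap (0 : Fin 2) 1) = ![y, x] := by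
      funext i; fin_cases i <;> simp
    rw [e] at h
    rw [h, neg_neg]
  LinearMap.mk₂ ℝ (fun x y => μ ![x, y])
    (fun x x' y => μ.map_vecCons_add _ _ _)
    (fun c x y => μ.map_vecCons_smul _ _ _)
    (fun x y y' => by
      rw [swap x, swap x y, swap x y', μ.map_vecCons_add, neg_add])
    (fun c x y => by
      rw [swap x, swap x y, μ.map_vecCons_smul, smul_neg])

theorem toBilin_self (μ : Alt2 V) (x : V) : toBilin μ x x = 0 :=
  μ.map_eq_zero_of_eq ![x, x] (i := 0) (j := 1) rfl (by decide)

theorem toBilin_swap (μ : Alt2 V) (x y : V) : toBilin μ x y = -toBilin μ y x := by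
  have h := toBilin_self μ (x + y)
  simp only [map_add, LinearMap.add_apply, toBilin_self, zero_add, add_zero] at h
  exact eq_neg_of_add_eq_zero_right h

/-- The Jacobi identity, read as the right action of a bracket. -/
theorem toBilin_toBilin {μ : Alt2 V} (hμ : μ ∈ lieStructures V) (x y z : V) :
    toBilin μ x (toBilin μ y z) =
      toBilin μ (toBilin μ x y) z - toBilin μ (toBilin μ x z) y := by
  have h : toBilin μ (toBilin μ x y) z + toBilin μ (toBilin μ y z) x
      + toBilin μ (toBilin μ z x) y = 0 := hμ x y z
  rw [toBilin_swap μ z x, map_neg, LinearMap.neg_apply] at h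
  rw [toBilin_swap μ x]
  linear_combination (norm := module) -h

theorem bracket_eq_map₂ (μ : Alt2 V) (A B : Submodule ℝ V) :
    bracket μ A B = Submodule.map₂ (toBilin μ) A B := by
  rw [Submodule.map₂_eq_span_image2]
  rfl

theorem lcs_succ (μ : Alt2 V) (i : ℕ) :
    lcs μ (i + 1) = Submodule.map₂ (toBilin μ) (lcs μ i) ⊤ :=
  bracket_eq_map₂ μ _ _

theorem toBilin_mem_lcs_succ (μ : Alt2 V) {i : ℕ} {x : V} (hx : x ∈ lcs μ i) (y : V) :
    toBilin μ x y ∈ lcs μ (i + 1) := by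
  rw [lcs_succ]
  exact Submodule.apply_mem_map₂ _ hx trivial

theorem lcs_antitone (μ : Alt2 V) : Antitone (lcs μ) := by
  refine antitone_nat_of_succ_le fun i => ?_
  induction i with
  | zero => exact le_top
  | succ i ih =>
    rw [lcs_succ μ (i + 1)]
    exact (Submodule.map₂_le_map₂_left ih).trans (lcs_succ μ i).ge

/-- `[𝔤ⁱ, 𝔤ʲ] ⊆ 𝔤ⁱ⁺ʲ⁺¹`. -/
theorem toBilin_mem_lcs {μ : Alt2 V} (hμ : μ ∈ lieStructures V) (j : ℕ) :
    ∀ {i : ℕ} {x y : V}, x ∈ lcs μ i → y ∈ lcs μ j → toBilin μ x y ∈ lcs μ (i + j + 1) := by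
  induction j with
  | zero => intro i x y hx _; exact toBilin_mem_lcs_succ μ hx y
  | succ j ih =>
    intro i x y hx hy
    suffices h : lcs μ (j + 1) ≤ (lcs μ (i + (j + 1) + 1)).comap (toBilin μ x) from h hy
    rw [lcs_succ, Submodule.map₂_le]
    intro u hu v _
    rw [Submodule.mem_comap, toBilin_toBilin hμ]
    refine Submodule.sub_mem _ (toBilin_mem_lcs_succ μ (ih hx hu) v) ?_
    -- The induction on `j` is uniform in `i`, so it applies to $[x,v]\in\mathfrak g^{i+1}$.
    have h := ih (toBilin_mem_lcs_succ μ hx v) hu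
    rwa [show i + 1 + j + 1 = i + (j + 1) + 1 by omega] at h

theorem toBilin_mem_lcs_of_le {μ : Alt2 V} (hμ : μ ∈ lieStructures V) {i j k : ℕ} {x y : V}
    (hx : x ∈ lcs μ i) (hy : y ∈ lcs μ j) (hk : k ≤ i + j + 1) : toBilin μ x y ∈ lcs μ k :=
  lcs_antitone μ hk (toBilin_mem_lcs hμ j hx hy)

theorem toBilin_eq_zero {μ : Alt2 V} (hμ : μ ∈ lieStructures V) {i j k : ℕ} {x y : V}
    (h0 : lcs μ k = ⊥) (hx : x ∈ lcs μ i) (hy : y ∈ lcs μ j) (hk : k ≤ i + j + 1) :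
    toBilin μ x y = 0 := by
  have h := toBilin_mem_lcs_of_le hμ hx hy hk
  rwa [h0, Submodule.mem_bot] at h

/-- A step at which the descending central series of a nilpotent structure is stationary is zero. -/
theorem lcs_eq_bot_of_le_succ {μ : Alt2 V} {k : ℕ} (h0 : lcs μ k = ⊥) {i : ℕ}
    (hi : lcs μ i ≤ lcs μ (i + 1)) : lcs μ i = ⊥ := by
  have h : ∀ m, lcs μ i ≤ lcs μ (i + m) := by
    intro m
    induction m with
    | zero => exact le_rfl
    | succ m ih =>
      refine hi.trans ?_
      rw [← add_assoc, lcs_succ, lcs_succ μ (i + m)]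
      exact Submodule.map₂_le_map₂_left ih
  exact le_bot_iff.1 ((h k).trans (h0 ▸ lcs_antitone μ (Nat.le_add_left k i)))

/-! ### Spanning a subspace modulo a smaller one -/

section Generators

variable [FiniteDimensional ℝ V] {W W' : Submodule ℝ V}

/-- One vector lowers the bound on the codimension by one; iteration gives generators modulo `W'`.
Only upper bounds are used, so generators may be redundant or zero. -/
theorem exists_mem_finrank_le_sup_span {k : ℕ}
    (h : Module.finrank ℝ W ≤ Module.finrank ℝ W' + (k + 1)) :
    ∃ a ∈ W, Module.finrank ℝ W ≤ Module.finrank ℝ ↥(W' ⊔ ℝ ∙ a) + k := by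
  by_cases hle : W ≤ W'
  · refine ⟨0, W.zero_mem, ?_⟩
    have := Submodule.finrank_mono (hle.trans (le_sup_left : W' ≤ W' ⊔ ℝ ∙ (0 : V)))
    omega
  · obtain ⟨a, ha, ha'⟩ := SetLike.not_le_iff_exists.1 hle
    refine ⟨a, ha, ?_⟩
    have : W' < W' ⊔ ℝ ∙ a := by
      refine lt_of_le_of_ne le_sup_left fun e => ha' ?_
      rw [e]
      exact Submodule.mem_sup_right (Submodule.mem_span_singleton_self a)
    have := Submodule.finrank_lt_finrank_of_lt this
    omega

theorem exists_one_generator (hW : W' ≤ W)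
    (h : Module.finrank ℝ W ≤ Module.finrank ℝ W' + 1) :
    ∃ a ∈ W, ∀ x ∈ W, ∃ r : ℝ, ∃ u ∈ W', x = r • a + u := by
  obtain ⟨a, ha, h⟩ := exists_mem_finrank_le_sup_span h
  refine ⟨a, ha, fun x hx => ?_⟩
  rw [← Submodule.eq_of_le_of_finrank_le (sup_le hW (by simpa using ha)) h] at hx
  obtain ⟨u, hu, v, hv, rfl⟩ := Submodule.mem_sup.1 hx
  obtain ⟨r, rfl⟩ := Submodule.mem_span_singleton.1 hv
  exact ⟨r, u, hu, add_comm _ _⟩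

theorem exists_two_generators (hW : W' ≤ W)
    (h : Module.finrank ℝ W ≤ Module.finrank ℝ W' + 2) :
    ∃ a ∈ W, ∃ b ∈ W, ∀ x ∈ W, ∃ r s : ℝ, ∃ u ∈ W', x = r • a + s • b + u := by
  obtain ⟨b, hb, h⟩ := exists_mem_finrank_le_sup_span h
  obtain ⟨a, ha, h⟩ := exists_one_generator (sup_le hW (by simpa using hb)) h
  refine ⟨a, ha, b, hb, fun x hx => ?_⟩
  obtain ⟨r, y, hy, rfl⟩ := h x hx
  obtain ⟨u, hu, v, hv, rfl⟩ := Submodule.mem_sup.1 hy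
  obtain ⟨s, rfl⟩ := Submodule.mem_span_singleton.1 hv
  exact ⟨r, s, u, hu, by abel⟩

theorem exists_three_generators (hW : W' ≤ W)
    (h : Module.finrank ℝ W ≤ Module.finrank ℝ W' + 3) :
    ∃ a ∈ W, ∃ b ∈ W, ∃ c ∈ W, ∀ x ∈ W, ∃ r s t : ℝ, ∃ u ∈ W',
      x = r • a + s • b + t • c + u := by
  obtain ⟨c, hc, h⟩ := exists_mem_finrank_le_sup_span h
  obtain ⟨a, ha, b, hb, h⟩ := exists_two_generators (sup_le hW (by simpa using hc)) h
  refine ⟨a, ha, b, hb, c, hc, fun x hx => ?_⟩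
  obtain ⟨r, s, y, hy, rfl⟩ := h x hx
  obtain ⟨u, hu, v, hv, rfl⟩ := Submodule.mem_sup.1 hy
  obtain ⟨t, rfl⟩ := Submodule.mem_span_singleton.1 hv
  exact ⟨r, s, t, u, hu, by abel⟩

end Generators

/-! ### Generators adapted to the bracket -/

/-- If `𝔤 = ℝa + ℝb + 𝔤¹` then `𝔤¹ = ℝ[a,b] + 𝔤²`. -/
theorem lcs_one_generator {μ : Alt2 V} {a b : V}
    (hg : ∀ x : V, ∃ r s : ℝ, ∃ u ∈ lcs μ 1, x = r • a + s • b + u) :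
    ∀ x ∈ lcs μ 1, ∃ r : ℝ, ∃ u ∈ lcs μ 2, x = r • toBilin μ a b + u := by
  suffices h : lcs μ 1 ≤ (ℝ ∙ toBilin μ a b) ⊔ lcs μ 2 by
    intro x hx
    obtain ⟨v, hv, u, hu, rfl⟩ := Submodule.mem_sup.1 (h hx)
    obtain ⟨r, rfl⟩ := Submodule.mem_span_singleton.1 hv
    exact ⟨r, u, hu, rfl⟩
  rw [lcs_succ, Submodule.map₂_le]
  intro x _ y _
  obtain ⟨r, s, u, hu, rfl⟩ := hg x
  obtain ⟨r', s', u', hu', rfl⟩ := hg y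
  refine Submodule.mem_sup.2 ⟨(r * s' - s * r') • toBilin μ a b,
    Submodule.smul_mem _ _ (Submodule.mem_span_singleton_self _),
    toBilin μ u (r' • a + s' • b + u') - toBilin μ u' (r • a + s • b),
    Submodule.sub_mem _ (toBilin_mem_lcs_succ μ hu _) (toBilin_mem_lcs_succ μ hu' _), ?_⟩
  simp only [map_add, map_smul, LinearMap.add_apply, LinearMap.smul_apply, toBilin_self,
    toBilin_swap μ b a, toBilin_swap μ u' a, toBilin_swap μ u' b]
  module

/-- If `𝔤 = ℝa + ℝb + ℝc + 𝔤¹` and `[a,b] ∈ 𝔤²` then `𝔤¹ = ℝ[a,c] + ℝ[b,c] + 𝔤²`. -/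
theorem lcs_one_generators {μ : Alt2 V} {a b c : V}
    (hg : ∀ x : V, ∃ r s t : ℝ, ∃ u ∈ lcs μ 1, x = r • a + s • b + t • c + u)
    (hab : toBilin μ a b ∈ lcs μ 2) :
    ∀ x ∈ lcs μ 1, ∃ r s : ℝ, ∃ u ∈ lcs μ 2,
      x = r • toBilin μ a c + s • toBilin μ b c + u := by
  suffices h : lcs μ 1 ≤ Submodule.span ℝ {toBilin μ a c, toBilin μ b c} ⊔ lcs μ 2 by
    intro x hx
    obtain ⟨v, hv, u, hu, rfl⟩ := Submodule.mem_sup.1 (h hx)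
    obtain ⟨r, s, rfl⟩ := Submodule.mem_span_pair.1 hv
    exact ⟨r, s, u, hu, rfl⟩
  rw [lcs_succ, Submodule.map₂_le]
  intro x _ y _
  obtain ⟨r, s, t, u, hu, rfl⟩ := hg x
  obtain ⟨r', s', t', u', hu', rfl⟩ := hg y
  refine Submodule.mem_sup.2 ⟨(r * t' - t * r') • toBilin μ a c + (s * t' - t * s') • toBilin μ b c,
    Submodule.mem_span_pair.2 ⟨_, _, rfl⟩,
    (r * s' - s * r') • toBilin μ a b + (toBilin μ u (r' • a + s' • b + t' • c + u')
      - toBilin μ u' (r • a + s • b + t • c)),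
    Submodule.add_mem _ (Submodule.smul_mem _ _ hab)
      (Submodule.sub_mem _ (toBilin_mem_lcs_succ μ hu _) (toBilin_mem_lcs_succ μ hu' _)), ?_⟩
  simp only [map_add, map_smul, LinearMap.add_apply, LinearMap.smul_apply, toBilin_self,
    toBilin_swap μ b a, toBilin_swap μ c a, toBilin_swap μ c b,
    toBilin_swap μ u' a, toBilin_swap μ u' b, toBilin_swap μ u' c]
  module

/-- If `𝔤` has three generators and `𝔤¹/𝔤²` has dimension at most two, the generators can be
chosen such that two of them commute modulo `𝔤²`. -/
theorem exists_generators_toBilin_mem [FiniteDimensional ℝ V] {μ : Alt2 V}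
    (h0 : Module.finrank ℝ (lcs μ 0) ≤ Module.finrank ℝ (lcs μ 1) + 3)
    (h1 : Module.finrank ℝ (lcs μ 1) ≤ Module.finrank ℝ (lcs μ 2) + 2) :
    ∃ a b c : V, (∀ x : V, ∃ r s t : ℝ, ∃ u ∈ lcs μ 1, x = r • a + s • b + t • c + u) ∧
      toBilin μ a b ∈ lcs μ 2 := by
  obtain ⟨x, -, y, -, z, -, hg⟩ := exists_three_generators (lcs_antitone μ zero_le_one) h0
  replace hg := fun v => hg v trivial
  obtain ⟨p, -, q, -, hpq⟩ := exists_two_generators (lcs_antitone μ one_le_two) h1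
  -- The three brackets are dependent modulo $\mathfrak g^2$, since two vectors span $\mathfrak g^1$
  -- there.
  have hd : ∃ r s t : ℝ, (r ≠ 0 ∨ s ≠ 0 ∨ t ≠ 0) ∧
      r • toBilin μ y z + s • toBilin μ z x + t • toBilin μ x y ∈ lcs μ 2 := by
    have hmem : ∀ v w, toBilin μ v w ∈ lcs μ 1 := fun v w =>
      toBilin_mem_lcs_succ μ (i := 0) trivial w
    obtain ⟨r₁, s₁, u₁, hu₁, e₁⟩ := hpq _ (hmem y z)
    obtain ⟨r₂, s₂, u₂, hu₂, e₂⟩ := hpq _ (hmem z x)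
    obtain ⟨r₃, s₃, u₃, hu₃, e₃⟩ := hpq _ (hmem x y)
    have key : ∀ r s t : ℝ, r * r₁ + s * r₂ + t * r₃ = 0 → r * s₁ + s * s₂ + t * s₃ = 0 →
        r • toBilin μ y z + s • toBilin μ z x + t • toBilin μ x y ∈ lcs μ 2 := by
      intro r s t hr hs
      have : r • toBilin μ y z + s • toBilin μ z x + t • toBilin μ x y
          = r • u₁ + s • u₂ + t • u₃ := by
        rw [e₁, e₂, e₃]
        linear_combination (norm := module) hr • p + hs • q
      rw [this]
      exact add_mem (add_mem (Submodule.smul_mem _ _ hu₁) (Submodule.smul_mem _ _ hu₂))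
        (Submodule.smul_mem _ _ hu₃)
    -- The cross product of the two coefficient rows is a relation; if it is zero, the rows are
    -- proportional and a relation is read off directly.
    by_cases hc : r₂ * s₃ - r₃ * s₂ ≠ 0 ∨ r₃ * s₁ - r₁ * s₃ ≠ 0 ∨ r₁ * s₂ - r₂ * s₁ ≠ 0
    · exact ⟨_, _, _, hc, key _ _ _ (by ring) (by ring)⟩
    · push Not at hc
      obtain ⟨c₁, c₂, c₃⟩ := hc
      by_cases hr : r₁ ≠ 0 ∨ r₂ ≠ 0
      · refine ⟨r₂, -r₁, 0, ?_, key _ _ _ (by ring) (by linarith)⟩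
        rcases hr with h | h <;> simp [h]
      · push Not at hr
        obtain ⟨rfl, rfl⟩ := hr
        by_cases hs : s₁ ≠ 0 ∨ s₂ ≠ 0
        · refine ⟨s₂, -s₁, 0, ?_, key _ _ _ (by ring) (by ring)⟩
          rcases hs with h | h <;> simp [h]
        · push Not at hs
          obtain ⟨rfl, rfl⟩ := hs
          exact ⟨1, 0, 0, by simp, key _ _ _ (by ring) (by ring)⟩
  -- Bivectors in three variables are decomposable: for $t\ne0$, $r\,y\wedge z+s\,z\wedge
  -- x+t\,x\wedge y=t\,(x-\tfrac rt z)\wedge(y-\tfrac st z)$.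
  have key : ∀ (x y z : V) (r s t : ℝ),
      (∀ v : V, ∃ r s t : ℝ, ∃ u ∈ lcs μ 1, v = r • x + s • y + t • z + u) → t ≠ 0 →
      r • toBilin μ y z + s • toBilin μ z x + t • toBilin μ x y ∈ lcs μ 2 →
      ∃ a b c : V, (∀ x : V, ∃ r s t : ℝ, ∃ u ∈ lcs μ 1, x = r • a + s • b + t • c + u) ∧
        toBilin μ a b ∈ lcs μ 2 := by
    intro x y z r s t hg ht hd
    refine ⟨x - (r / t) • z, y - (s / t) • z, z, fun v => ?_, ?_⟩
    · obtain ⟨r', s', t', u, hu, rfl⟩ := hg v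
      exact ⟨r', s', t' + r' * (r / t) + s' * (s / t), u, hu, by module⟩
    · convert Submodule.smul_mem _ t⁻¹ hd using 1
      simp only [map_sub, map_smul, LinearMap.sub_apply, LinearMap.smul_apply, toBilin_self,
        toBilin_swap μ z x, toBilin_swap μ z y, smul_add, smul_smul, inv_mul_cancel₀ ht]
      module
  obtain ⟨r, s, t, hne, hd⟩ := hd
  rcases hne with h | h | h
  · refine key y z x s t r (fun v => ?_) h (by convert hd using 1; abel)
    obtain ⟨r', s', t', u, hu, rfl⟩ := hg v
    exact ⟨s', t', r', u, hu, by abel⟩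
  · refine key z x y t r s (fun v => ?_) h (by convert hd using 1; abel)
    obtain ⟨r', s', t', u, hu, rfl⟩ := hg v
    exact ⟨t', r', s', u, hu, by abel⟩
  · exact key x y z r s t hg h hd

/-! ### Four-step algebras are metabelian -/

/-- `𝔤` is metabelian if `𝔤⁴ = 0` and `𝔤` has the shape `(3,2,1,1)`, where `𝔤/𝔤¹` is generated by
`a`, `b`, `c` with `[a,b] ∈ 𝔤²`. -/
theorem toBilin_toBilin_eq_zero_of_generators {μ : Alt2 V} (hμ : μ ∈ lieStructures V)
    (h4 : lcs μ 4 = ⊥) {a b c z w : V} (hz : z ∈ lcs μ 2)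
    (hab : toBilin μ a b ∈ lcs μ 2)
    (h2 : ∀ x ∈ lcs μ 2, ∃ r : ℝ, ∃ u ∈ lcs μ 3, x = r • z + u)
    (h3 : ∀ x ∈ lcs μ 3, ∃ r : ℝ, x = r • w) :
    toBilin μ (toBilin μ a c) (toBilin μ b c) = 0 := by
  have hmem : ∀ v w, toBilin μ v w ∈ lcs μ 1 := fun v w =>
    toBilin_mem_lcs_succ μ (i := 0) trivial w
  set p := toBilin μ a c with hp
  set q := toBilin μ b c with hq
  have hp1 : p ∈ lcs μ 1 := hmem _ _
  have hq1 : q ∈ lcs μ 1 := hmem _ _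
  obtain ⟨A, hA⟩ := h3 _ (toBilin_mem_lcs_succ μ hz a)
  obtain ⟨B, hB⟩ := h3 _ (toBilin_mem_lcs_succ μ hz b)
  obtain ⟨C, hC⟩ := h3 _ (toBilin_mem_lcs_succ μ hz c)
  have h3zero : ∀ u ∈ lcs μ 3, ∀ v, toBilin μ u v = 0 := fun u hu v =>
    toBilin_eq_zero hμ h4 hu (j := 0) trivial le_rfl
  obtain ⟨α, u₁, hu₁, e₁⟩ := h2 _ (toBilin_mem_lcs_succ μ hp1 a)
  obtain ⟨β, u₂, hu₂, e₂⟩ := h2 _ (toBilin_mem_lcs_succ μ hp1 b)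
  obtain ⟨γ, u₃, hu₃, e₃⟩ := h2 _ (toBilin_mem_lcs_succ μ hp1 c)
  obtain ⟨δ, u₄, hu₄, e₄⟩ := h2 _ (toBilin_mem_lcs_succ μ hq1 b)
  obtain ⟨ε, u₅, hu₅, e₅⟩ := h2 _ (toBilin_mem_lcs_succ μ hq1 c)
  -- Jacobi on $a,b,c$ with $[a,b]\in\mathfrak g^2$: $[q,a]$ and $[p,b]$ have the same coefficient
  -- `β` modulo $\mathfrak g^3$.
  have e₆ : toBilin μ q a = β • z + (u₂ - toBilin μ (toBilin μ a b) c) := by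
    have h := toBilin_toBilin hμ a b c
    rw [← hp, ← hq, toBilin_swap μ a q, e₂] at h
    linear_combination (norm := module) -h
  have hu₆ : u₂ - toBilin μ (toBilin μ a b) c ∈ lcs μ 3 :=
    sub_mem hu₂ (toBilin_mem_lcs_succ μ hab c)
  have j₁ := toBilin_toBilin hμ p a b
  have j₂ := toBilin_toBilin hμ q a b
  have j₃ := toBilin_toBilin hμ p a c
  have j₄ := toBilin_toBilin hμ q b c
  have j₅ := toBilin_toBilin hμ p b c
  have j₆ := toBilin_toBilin hμ q a c
  rw [toBilin_eq_zero hμ h4 hp1 hab le_rfl] at j₁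
  rw [toBilin_eq_zero hμ h4 hq1 hab le_rfl] at j₂
  rw [← hp, toBilin_self] at j₃
  rw [← hq, toBilin_self] at j₄
  rw [← hq] at j₅
  rw [← hp, toBilin_swap] at j₆
  simp only [e₁, e₂, e₃, e₄, e₅, e₆, map_add, map_smul, LinearMap.add_apply,
    LinearMap.smul_apply, hA, hB, hC, h3zero _ hu₁, h3zero _ hu₂, h3zero _ hu₃, h3zero _ hu₄,
    h3zero _ hu₅, h3zero _ hu₆, add_zero, smul_smul, ← sub_smul] at j₁ j₂ j₃ j₄ j₅ j₆
  by_cases hw : w = 0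
  · rw [j₅, hw, smul_zero]
  have cancel : ∀ r : ℝ, 0 = r • w → r = 0 := fun r hr =>
    (smul_eq_zero.1 hr.symm).resolve_right hw
  replace j₁ := cancel _ j₁
  replace j₂ := cancel _ j₂
  replace j₃ := cancel _ j₃
  replace j₄ := cancel _ j₄
  -- Antisymmetry: `j₅` and `j₆` compute $[p,q]$ and $-[p,q]$.
  have j₇ : β * C - γ * B + (β * C - ε * A) = 0 := by
    refine cancel _ ?_
    rw [add_smul, ← j₅, ← j₆, add_neg_cancel]
  rw [j₅]
  suffices h : β * C - γ * B = 0 by rw [h, zero_smul]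
  by_cases hA0 : A = 0
  · subst hA0
    by_cases hB0 : B = 0
    · subst hB0; linarith
    · have hβ : β = 0 := by
        have : β * B = 0 := by linarith
        exact (mul_eq_zero.1 this).resolve_right hB0
      subst hβ; linarith
  · refine (mul_eq_zero.1 (?_ : A * (β * C - γ * B) = 0)).resolve_left hA0
    linear_combination B * j₃ - C * j₁

/-- A nilpotent Lie algebra with `𝔤⁴ = 0` of dimension at most seven is metabelian. -/
theorem toBilin_lcs_one_eq_zero [FiniteDimensional ℝ V] (hV : Module.finrank ℝ V ≤ 7)
    {μ : Alt2 V} (hμ : μ ∈ lieStructures V) (h4 : lcs μ 4 = ⊥) {x y : V}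
    (hx : x ∈ lcs μ 1) (hy : y ∈ lcs μ 1) : toBilin μ x y = 0 := by
  have hle : ∀ i, lcs μ (i + 1) ≤ lcs μ i := fun i => lcs_antitone μ i.le_succ
  have h32 : lcs μ 3 ≤ lcs μ 2 := hle 2
  have h43 : lcs μ 4 ≤ lcs μ 3 := hle 3
  have hspan : ∀ p ∈ lcs μ 1, (∀ x ∈ lcs μ 1, ∃ r : ℝ, ∃ u ∈ lcs μ 2, x = r • p + u) →
      toBilin μ x y = 0 := by
    intro p hp h
    obtain ⟨r, u, hu, rfl⟩ := h x hx
    obtain ⟨r', u', hu', rfl⟩ := h y hy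
    simp [toBilin_self, toBilin_eq_zero hμ h4 hp hu' le_rfl,
      toBilin_eq_zero hμ h4 hu hp le_rfl, toBilin_eq_zero (i := 2) (j := 2) hμ h4 hu hu' (by omega)]
  by_contra hne
  have hxy : toBilin μ x y ∈ lcs μ 3 := toBilin_mem_lcs hμ 1 hx hy
  -- The bounds `d3`, `d2`, `d1`, `d0` bound the last four quotients below by 1, 1, 2, 3; these sum
  -- to 7, so all are equalities.
  have d3 : Module.finrank ℝ (lcs μ 3) ≠ 0 := fun h => by
    rw [Submodule.finrank_eq_zero.1 h] at hxy
    exact hne ((Submodule.mem_bot ℝ).1 hxy)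
  have d2 : ¬ Module.finrank ℝ (lcs μ 2) ≤ Module.finrank ℝ (lcs μ 3) := fun h => by
    have h2 := lcs_eq_bot_of_le_succ h4 (Submodule.eq_of_le_of_finrank_le (hle 2) h).ge
    have := Submodule.finrank_mono h32
    rw [Submodule.finrank_eq_zero.2 h2] at this
    omega
  have d1 : ¬ Module.finrank ℝ (lcs μ 1) ≤ Module.finrank ℝ (lcs μ 2) + 1 := fun h => by
    obtain ⟨p, hp, h⟩ := exists_one_generator (hle 1) h
    exact hne (hspan p hp h)
  have d0 : ¬ Module.finrank ℝ (lcs μ 0) ≤ Module.finrank ℝ (lcs μ 1) + 2 := fun h => by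
    obtain ⟨a, -, b, -, h⟩ := exists_two_generators (hle 0) h
    exact hne (hspan _ (toBilin_mem_lcs_succ μ (i := 0) trivial b)
      (lcs_one_generator fun x => h x trivial))
  have hd : Module.finrank ℝ (lcs μ 0) ≤ 7 := (Submodule.finrank_le _).trans hV
  obtain ⟨a, b, c, hg, hab⟩ := exists_generators_toBilin_mem (μ := μ) (by omega) (by omega)
  obtain ⟨z, hz, h2⟩ := exists_one_generator h32 (by omega)
  obtain ⟨w, -, h3⟩ := exists_one_generator h43 (by omega)
  have hpq := toBilin_toBilin_eq_zero_of_generators hμ h4 (c := c) (w := w) hz hab h2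
    fun v hv => by
      obtain ⟨r, u, hu, rfl⟩ := h3 v hv
      rw [h4, Submodule.mem_bot] at hu
      exact ⟨r, by rw [hu, add_zero]⟩
  have hac : toBilin μ a c ∈ lcs μ 1 := toBilin_mem_lcs_succ μ (i := 0) trivial c
  have hbc : toBilin μ b c ∈ lcs μ 1 := toBilin_mem_lcs_succ μ (i := 0) trivial c
  have hqp : toBilin μ (toBilin μ b c) (toBilin μ a c) = 0 := by
    rw [toBilin_swap, hpq, neg_zero]
  obtain ⟨r, s, u, hu, rfl⟩ := lcs_one_generators hg hab x hx
  obtain ⟨r', s', u', hu', rfl⟩ := lcs_one_generators hg hab y hy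
  apply hne
  simp [toBilin_self, hpq, hqp, toBilin_eq_zero hμ h4 hac hu' le_rfl,
    toBilin_eq_zero hμ h4 hbc hu' le_rfl, toBilin_eq_zero hμ h4 hu hac le_rfl,
    toBilin_eq_zero hμ h4 hu hbc le_rfl, toBilin_eq_zero (i := 2) (j := 2) hμ h4 hu hu' (by omega)]

/-! ### The filiform case and $[\mathfrak g^1,\mathfrak g^3]=0$ -/

/-- In a filiform Lie algebra with `𝔤/𝔤¹` generated by `a`, `b`, the generators can be chosen such
that `[[a,b],b] ∈ 𝔤³`. -/
theorem exists_filiform_generators [FiniteDimensional ℝ V] {μ : Alt2 V}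
    (h0 : Module.finrank ℝ (lcs μ 0) ≤ Module.finrank ℝ (lcs μ 1) + 2)
    (h2 : Module.finrank ℝ (lcs μ 2) ≤ Module.finrank ℝ (lcs μ 3) + 1) :
    ∃ a b : V, (∀ x : V, ∃ r s : ℝ, ∃ u ∈ lcs μ 1, x = r • a + s • b + u) ∧
      toBilin μ (toBilin μ a b) b ∈ lcs μ 3 := by
  obtain ⟨a, -, b, -, hg⟩ := exists_two_generators (lcs_antitone μ zero_le_one) h0
  replace hg := fun v => hg v trivial
  obtain ⟨e, -, he⟩ := exists_one_generator (lcs_antitone μ (Nat.le_succ 2)) h2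
  have hp : toBilin μ a b ∈ lcs μ 1 := toBilin_mem_lcs_succ μ (i := 0) trivial b
  obtain ⟨s, u, hu, es⟩ := he _ (toBilin_mem_lcs_succ μ hp a)
  obtain ⟨t, v, hv, et⟩ := he _ (toBilin_mem_lcs_succ μ hp b)
  by_cases ht : t = 0
  · refine ⟨a, b, hg, ?_⟩
    rw [et, ht, zero_smul, zero_add]
    exact hv
  -- Modulo $\mathfrak g^3$, $[p,a]$ and $[p,b]$ are $s e$ and $t e$, so $a-\tfrac st b$ brackets
  -- $p$ into $\mathfrak g^3$.
  · refine ⟨b, a - (s / t) • b, fun x => ?_, ?_⟩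
    · obtain ⟨r', s', w, hw, rfl⟩ := hg x
      exact ⟨s' + r' * (s / t), r', w, hw, by module⟩
    · have : toBilin μ (toBilin μ b (a - (s / t) • b)) (a - (s / t) • b) = (s / t) • v - u := by
        simp only [map_sub, map_smul, toBilin_self, toBilin_swap μ b a, smul_zero, sub_zero,
          map_neg, LinearMap.neg_apply, es, et]
        have hst : s / t * t = s := div_mul_cancel₀ s ht
        linear_combination (norm := module) hst • e
      rw [this]
      exact sub_mem (Submodule.smul_mem _ _ hv) hu

/-- If `𝔤⁶ = 0` and the steps `𝔤⁰/𝔤¹`, `𝔤²/𝔤³`, `𝔤⁴/𝔤⁵` have dimensions at most `2`, `1`, `1`,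
then `[𝔤¹, 𝔤³] = 0`. -/
theorem toBilin_lcs_one_lcs_three_eq_zero_of_filiform [FiniteDimensional ℝ V] {μ : Alt2 V}
    (hμ : μ ∈ lieStructures V) (h6 : lcs μ 6 = ⊥)
    (h0 : Module.finrank ℝ (lcs μ 0) ≤ Module.finrank ℝ (lcs μ 1) + 2)
    (h2 : Module.finrank ℝ (lcs μ 2) ≤ Module.finrank ℝ (lcs μ 3) + 1)
    (h4 : Module.finrank ℝ (lcs μ 4) ≤ Module.finrank ℝ (lcs μ 5) + 1) {x y : V}
    (hx : x ∈ lcs μ 1) (hy : y ∈ lcs μ 3) : toBilin μ x y = 0 := by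
  obtain ⟨a, b, hg, hb⟩ := exists_filiform_generators h0 h2
  obtain ⟨z, hz, h4⟩ := exists_one_generator (lcs_antitone μ (Nat.le_succ 4)) h4
  have hg1 := lcs_one_generator hg
  set p := toBilin μ a b with hp
  have hp1 : p ∈ lcs μ 1 := toBilin_mem_lcs_succ μ (i := 0) trivial b
  set e := toBilin μ p a with he
  have he2 : e ∈ lcs μ 2 := toBilin_mem_lcs_succ μ hp1 a
  set f := toBilin μ e a with hf
  have hf3 : f ∈ lcs μ 3 := toBilin_mem_lcs_succ μ he2 a
  have top : ∀ {v : V}, v ∈ lcs μ 5 → ∀ w, toBilin μ v w = 0 := fun hv w =>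
    toBilin_eq_zero hμ h6 hv (j := 0) trivial le_rfl
  have heb : toBilin μ e b = toBilin μ (toBilin μ p b) a := by
    have h := toBilin_toBilin hμ p a b
    rw [← hp, toBilin_self, ← he] at h
    exact (sub_eq_zero.1 h.symm)
  have heb4 : toBilin μ e b ∈ lcs μ 4 := heb ▸ toBilin_mem_lcs_succ μ hb a
  have hfb : toBilin μ f b = toBilin μ (toBilin μ e b) a - toBilin μ p e := by
    have h := toBilin_toBilin hμ e a b
    rw [← hp, ← hf, toBilin_swap] at h
    linear_combination (norm := module) -h
  obtain ⟨l, u, hu, hpe⟩ := h4 _ (toBilin_mem_lcs_of_le hμ hp1 he2 le_rfl)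
  obtain ⟨k, v, hv, hfa⟩ := h4 _ (toBilin_mem_lcs_succ μ hf3 a)
  have hpf : toBilin μ p f = l • toBilin μ z a := by
    have h := toBilin_toBilin hμ p e a
    rw [← hf, ← he, toBilin_self, hpe] at h
    simpa [top hu] using h
  have hpf' : -toBilin μ p f = k • toBilin μ z b + l • toBilin μ z a := by
    have h := toBilin_toBilin hμ f a b
    rw [← hp, toBilin_swap, hfb, hfa, hpe] at h
    rw [h]
    simp [top hu, top hv, top (toBilin_mem_lcs_succ μ heb4 a)]
  have hl : l • toBilin μ z b = 0 := by
    have h := toBilin_toBilin hμ p e b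
    rw [toBilin_eq_zero hμ h6 hp1 heb4 le_rfl, hpe, toBilin_eq_zero hμ h6 hb he2 le_rfl] at h
    simpa [top hu] using h.symm
  -- Either $l=0$ and $[p,f]=l[z,a]=0$, or $[z,b]=0$ and then $-[p,f]=l[z,a]=[p,f]$.
  have hpf0 : toBilin μ p f = 0 := by
    rcases smul_eq_zero.1 hl with h | h
    · rw [hpf, h, zero_smul]
    · rw [h, smul_zero, zero_add, ← hpf] at hpf'
      have h2 : (2 : ℝ) • toBilin μ p f = 0 := by
        linear_combination (norm := module) -hpf'
      simpa using h2
  have span2 : lcs μ 2 ≤ (ℝ ∙ e) ⊔ lcs μ 3 := by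
    rw [lcs_succ, Submodule.map₂_le]
    intro x hx y _
    obtain ⟨r, u, hu, rfl⟩ := hg1 x hx
    obtain ⟨r', s', u', hu', rfl⟩ := hg y
    refine Submodule.mem_sup.2 ⟨(r * r') • e,
      Submodule.smul_mem _ _ (Submodule.mem_span_singleton_self _),
      (r * s') • toBilin μ p b + r • toBilin μ p u' + toBilin μ u (r' • a + s' • b + u'),
      add_mem (add_mem (Submodule.smul_mem _ _ hb)
        (Submodule.smul_mem _ _ (toBilin_mem_lcs hμ 1 hp1 hu'))) (toBilin_mem_lcs_succ μ hu _), ?_⟩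
    simp only [map_add, map_smul, LinearMap.add_apply, LinearMap.smul_apply, ← he]
    module
  have span3 : lcs μ 3 ≤ (ℝ ∙ f) ⊔ lcs μ 4 := by
    rw [lcs_succ, Submodule.map₂_le]
    intro x hx y _
    obtain ⟨v, hv, u, hu, rfl⟩ := Submodule.mem_sup.1 (span2 hx)
    obtain ⟨r, rfl⟩ := Submodule.mem_span_singleton.1 hv
    obtain ⟨r', s', u', hu', rfl⟩ := hg y
    refine Submodule.mem_sup.2 ⟨(r * r') • f,
      Submodule.smul_mem _ _ (Submodule.mem_span_singleton_self _),
      (r * s') • toBilin μ e b + r • toBilin μ e u' + toBilin μ u (r' • a + s' • b + u'),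
      add_mem (add_mem (Submodule.smul_mem _ _ heb4)
        (Submodule.smul_mem _ _ (toBilin_mem_lcs hμ 1 he2 hu'))) (toBilin_mem_lcs_succ μ hu _), ?_⟩
    simp only [map_add, map_smul, LinearMap.add_apply, LinearMap.smul_apply, ← hf]
    module
  obtain ⟨r, u', hu', rfl⟩ := hg1 x hx
  obtain ⟨w, hw, v', hv', rfl⟩ := Submodule.mem_sup.1 (span3 hy)
  obtain ⟨r', rfl⟩ := Submodule.mem_span_singleton.1 hw
  simp [hpf0, toBilin_eq_zero hμ h6 hp1 hv' le_rfl, toBilin_eq_zero hμ h6 hu' hf3 le_rfl,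
    toBilin_eq_zero (i := 2) (j := 4) hμ h6 hu' hv' (by omega)]

/-- A nilpotent Lie algebra of dimension at most seven satisfies `[𝔤¹, 𝔤³] = 0`. -/
theorem toBilin_lcs_one_lcs_three_eq_zero [FiniteDimensional ℝ V]
    (hV : Module.finrank ℝ V ≤ 7) {μ : Alt2 V} (hμ : μ ∈ allNilStructures V) {x y : V}
    (hx : x ∈ lcs μ 1) (hy : y ∈ lcs μ 3) : toBilin μ x y = 0 := by
  obtain ⟨hμ, k, hk⟩ := hμ
  by_cases h5 : lcs μ 5 = ⊥
  · exact toBilin_eq_zero hμ h5 hx hy le_rfl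
  have hle : ∀ i, lcs μ (i + 1) ≤ lcs μ i := fun i => lcs_antitone μ i.le_succ
  have drop : ∀ i ≤ 5, Module.finrank ℝ (lcs μ (i + 1)) < Module.finrank ℝ (lcs μ i) := by
    intro i hi
    refine Submodule.finrank_lt_finrank_of_lt (lt_of_le_not_ge (hle i) fun h => h5 ?_)
    exact le_bot_iff.1 (lcs_eq_bot_of_le_succ hk h ▸ lcs_antitone μ hi)
  -- With a single generator, taking $b=0$ as the second gives $\mathfrak g^1=\mathfrak g^2$.
  have drop0 : ¬ Module.finrank ℝ (lcs μ 0) ≤ Module.finrank ℝ (lcs μ 1) + 1 := fun h => by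
    obtain ⟨a, -, ha⟩ := exists_one_generator (hle 0) h
    have h12 : lcs μ 1 ≤ lcs μ 2 := fun x hx => by
      obtain ⟨r, u, hu, rfl⟩ := lcs_one_generator (a := a) (b := 0) (fun x => by
        obtain ⟨r, u, hu, e⟩ := ha x trivial
        exact ⟨r, 0, u, hu, by simpa using e⟩) x hx
      simpa using hu
    exact h5 (le_bot_iff.1 (lcs_eq_bot_of_le_succ hk h12 ▸ lcs_antitone μ (by omega : 1 ≤ 5)))
  have hd : Module.finrank ℝ (lcs μ 0) ≤ 7 := (Submodule.finrank_le _).trans hV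
  have d1 := drop 1 (by omega)
  have d2 := drop 2 (by omega)
  have d3 := drop 3 (by omega)
  have d4 := drop 4 (by omega)
  have d5 := drop 5 (by omega)
  simp only [Nat.reduceAdd] at d1 d2 d3 d4 d5
  -- The drops are at least 2,1,1,1,1,1, with sum 7, so each is exact and $\mathfrak g^6=0$.
  exact toBilin_lcs_one_lcs_three_eq_zero_of_filiform hμ (Submodule.finrank_eq_zero.1 (by omega))
    (by omega) (by omega) (by omega) hx hy

/-! ### Iterated brackets and the main theorem -/

theorem nilOp_mem_lcs (μ : Alt2 V) (k : ℕ) (x : Fin (k + 1) → V) : nilOp μ k x ∈ lcs μ k := by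
  induction k with
  | zero => trivial
  | succ k ih => exact toBilin_mem_lcs_succ μ (ih _) _

end NilVar

theorem mainTheorem6 (V : Type*) [AddCommGroup V] [Module ℝ V] :
    (∀ n ∈ ({5, 6, 7} : Set ℕ), Module.finrank ℝ V = n →
      NilVar.nilStructures V 4 ⊆ NilVar.snStructures V 3 (by norm_num)) ∧
    (Module.finrank ℝ V = 7 →
      NilVar.nilStructures V 6 ⊆ NilVar.snStructures V 5 (by norm_num)) ∧
    (Module.finrank ℝ V = 7 → ∀ μ ∈ NilVar.allNilStructures V,
      NilVar.bracket μ (NilVar.lcs μ 1) (NilVar.lcs μ 3) = ⊥) := by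
  refine ⟨?_, ?_, ?_⟩
  · rintro n hn hV μ ⟨hμ, h4⟩
    simp only [Set.mem_insert_iff, Set.mem_singleton_iff] at hn
    have : FiniteDimensional ℝ V := FiniteDimensional.of_finrank_pos (by omega)
    exact ⟨hμ, fun x => NilVar.toBilin_lcs_one_eq_zero (by omega) hμ h4
      (NilVar.toBilin_mem_lcs_succ μ (i := 0) trivial _) (NilVar.nilOp_mem_lcs μ 1 _)⟩
  · rintro hV μ ⟨hμ, h6⟩
    have : FiniteDimensional ℝ V := FiniteDimensional.of_finrank_pos (by omega)
    exact ⟨hμ, fun x => NilVar.toBilin_lcs_one_lcs_three_eq_zero hV.le ⟨hμ, 6, h6⟩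
      (NilVar.toBilin_mem_lcs_succ μ (i := 0) trivial _) (NilVar.nilOp_mem_lcs μ 3 _)⟩
  · intro hV μ hμ
    have : FiniteDimensional ℝ V := FiniteDimensional.of_finrank_pos (by omega)
    rw [NilVar.bracket_eq_map₂, eq_bot_iff, Submodule.map₂_le]
    intro x hx y hy
    exact (Submodule.mem_bot ℝ).2 (NilVar.toBilin_lcs_one_lcs_three_eq_zero hV.le hμ hx hy)
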